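/- Let $\mathscr A$ be an abelian category with all small limits and colimits. A model structure on $\mathscr A$ is called abelian if its cofibrations are the monomorphisms with cofibrant cokernel and its fibrations are the epimorphisms with fibrant kernel; it is injective if every object is cofibrant. Write $\mathcal C,\mathcal W,\mathcal F$ for the classes of cofibrant, weakly trivial and fibrant objects. An abelian model structure is hereditary if both $\mathcal C$ and $\mathcal C\cap\mathcal W$ are closed under kernels of epimorphisms and both $\mathcal F$ and $\mathcal W\cap\mathcal F$ are closed under cokernels of monomorphisms. For a model structure $\mathcal M$ on $\mathscr A$ let $\mathrm{Ho}(\mathcal M)$ be the localization of $\mathscr A$ at the weak equivalences and let $\Omega:\mathrm{Ho}(\mathcal M)\to\mathrm{Ho}(\mathcal M)$ be the loop functor, which sends a fibrant object $Y$ to the kernel of a fibration $P\to Y$ with $P$ cofibrant and weakly trivial. For a class $K$ of objects, a morphism $f:A\to B$ is a $K$-colocal equivalence if $\mathrm{Ho}(\mathcal M)(X,\Omega^kA)\to\mathrm{Ho}(\mathcal M)(X,\Omega^kB)$ is bijective for all $X\in K$ and $k\ge 0$. For a class $\mathcal L$ of morphisms, an object $X$ is $\mathcal L$-colocal if this map is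 bijective for all $f:A\to B$ in $\mathcal L$ and all $k\ge0$; an $\mathcal L$-colocal equivalence is a $K$-colocal equivalence for $K$ the class of $\mathcal L$-colocal objects. The right Bousfield localization of $\mathcal M$ with respect to $\mathcal L$ is, if it exists, the model structure on $\mathscr A$ whose weak equivalences are the $\mathcal L$-colocal equivalences of $\mathcal M$, whose fibrations are the fibrations of $\mathcal M$, and whose cofibrations are the morphisms with the left lifting property with respect to its trivial fibrations. Proposition. Let $\mathcal M_1$ and $\mathcal M_2$ be injective abelian model structures on $\mathscr A$, with classes $\mathcal W_i$ of weakly trivial and $\mathcal F_i$ of fibrant objects, such that $\mathcal F_2\subseteq\mathcal F_1$. Then there is a hereditary abelian model structure $\mathcal M_1/\mathcal M_2$ on $\mathscr A$ with $\mathcal C=\mathcal W_2$, $\mathcal F=\mathcal F_1$ and $$\mathcal W=\{X\in\mathscr A\mid \text{there is an exact sequence } 0\to X\to A\to B\to 0 \text{ with } A\in\mathcal F_2,\ B\in\mathcal W_1\},$$ and $\mathcal M_1/\mathcal M_2$ is the right Bousfield localization of $\mathcal M_1$ with respect to $\mathcal L=\{0\to X\mid X\in\mathcal F_2\}$. In particular,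 its weak equivalences are exactly the $\mathcal L$-colocal equivalences of $\mathcal M_1$. -/

import Mathlib

open CategoryTheory CategoryTheory.Limits HomotopicalAlgebra
open scoped ZeroObject

universe v u

set_option linter.unusedSectionVars false

namespace AbelianModel

section Loop

variable {A : Type u} [Category.{v} A] [Abelian A] [ModelCategory A]

variable (A) in
/-- The homotopy category of a model category: the localization at the weak equivalences. -/
abbrev Ho : Type u := (weakEquivalences A).Localization

variable (A) in
/-- The localization functor `A ⥤ Ho A`. -/
abbrev toHo : A ⥤ Ho A := (weakEquivalences A).Q

/-- What is needed to compute the loop object of `Y`: a fibrant replacement `r : Y ⟶ Y'`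
(a trivial cofibration with `Y'` fibrant) and a path fibration `p : P ⟶ Y'`, i.e. a fibration
whose source `P` is cofibrant and weakly trivial. The loop object is the kernel of `p`. -/
structure LoopData (Y : A) where
  Y' : A
  P : A
  r : Y ⟶ Y'
  p : P ⟶ Y'
  cof_r : Cofibration r
  weq_r : WeakEquivalence r
  fib_Y' : IsFibrant Y'
  fib_p : Fibration p
  cof_P : IsCofibrant P
  weq_P : WeakEquivalence (initial.to P)

attribute [instance] LoopData.cof_r LoopData.weq_r LoopData.fib_Y' LoopData.fib_p
  LoopData.cof_P LoopData.weq_P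

/-- The loop object `0 ⟶ ΩY ⟶ P ⟶ Y' ⟶ 0`. -/
noncomputable abbrev LoopData.loop {Y : A} (D : LoopData Y) : A := kernel D.p

/-- A lift of `f : Y ⟶ Z` to fibrant replacements and path fibrations. -/
structure LoopData.Hom {Y Z : A} (D : LoopData Y) (E : LoopData Z) (f : Y ⟶ Z) where
  f' : D.Y' ⟶ E.Y'
  e : D.P ⟶ E.P
  wr : D.r ≫ f' = f ≫ E.r
  wp : D.p ≫ f' = e ≫ E.p

/-- The map induced on loop objects. -/
noncomputable def LoopData.Hom.loop {Y Z : A} {D : LoopData Y} {E : LoopData Z} {f : Y ⟶ Z}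
    (φ : D.Hom E f) : D.loop ⟶ E.loop :=
  kernel.map D.p E.p φ.e φ.f' φ.wp

def LoopData.Hom.id {Y : A} (D : LoopData Y) : D.Hom D (𝟙 Y) where
  f' := 𝟙 _
  e := 𝟙 _
  wr := by simp
  wp := by simp

def LoopData.Hom.comp {X Y Z : A} {D : LoopData X} {E : LoopData Y} {F : LoopData Z}
    {f : X ⟶ Y} {g : Y ⟶ Z} (φ : D.Hom E f) (ψ : E.Hom F g) : D.Hom F (f ≫ g) where
  f' := φ.f' ≫ ψ.f'
  e := φ.e ≫ ψ.e
  wr := by rw [reassoc_of% φ.wr, ψ.wr, Category.assoc]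
  wp := by rw [reassoc_of% φ.wp, ψ.wp, Category.assoc]

lemma LoopData.Hom.loop_id {Y : A} (D : LoopData Y) :
    (LoopData.Hom.id D).loop = 𝟙 _ := by
  rw [← cancel_mono (kernel.ι D.p)]
  simp [LoopData.Hom.loop, LoopData.Hom.id]

lemma LoopData.Hom.loop_comp {X Y Z : A} {D : LoopData X} {E : LoopData Y} {F : LoopData Z}
    {f : X ⟶ Y} {g : Y ⟶ Z} (φ : D.Hom E f) (ψ : E.Hom F g) :
    (φ.comp ψ).loop = φ.loop ≫ ψ.loop := by
  rw [← cancel_mono (kernel.ι F.p)]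
  simp [LoopData.Hom.loop, LoopData.Hom.comp]

lemma LoopData.Hom.loop_ι {Y Z : A} {D : LoopData Y} {E : LoopData Z} {f : Y ⟶ Z}
    (φ : D.Hom E f) : φ.loop ≫ kernel.ι E.p = kernel.ι D.p ≫ φ.e := by
  simp [LoopData.Hom.loop]

instance LoopData.fib_P {Y : A} (D : LoopData Y) : IsFibrant D.P :=
  isFibrant_of_fibration D.p

lemma LoopData.weq_to {Y : A} (D : LoopData Y) : WeakEquivalence (terminal.from D.P) := by
  have h : initial.to D.P ≫ terminal.from D.P = initial.to (⊤_ A) := initialIsInitial.hom_ext _ _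
  have : IsIso (initial.to (⊤_ A)) :=
    ⟨0, (initialIsInitial (C := A)).hom_ext _ _, (terminalIsTerminal (C := A)).hom_ext _ _⟩
  have : WeakEquivalence (initial.to (⊤_ A)) := inferInstance
  exact weakEquivalence_of_precomp_of_fac h

/-- Maps in `A` that differ by a map factoring through a fibrant weakly trivial object become
equal in the homotopy category. -/
lemma toHo_map_add {X Y P : A} [IsFibrant P] [WeakEquivalence (terminal.from P)]
    (u : X ⟶ Y) (i : X ⟶ P) (s : P ⟶ Y) :
    (toHo A).map (u + i ≫ s) = (toHo A).map u := by
  have hw : WeakEquivalence (prod.fst : X ⨯ P ⟶ X) := by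
    rw [weakEquivalence_iff]
    have hP : trivialFibrations A (terminal.from P) := mem_trivialFibrations _
    exact (MorphismProperty.of_isPullback
      (IsPullback.of_isLimit_binaryFan_of_isTerminal
        (limit.isLimit (pair X P)) terminalIsTerminal).flip hP).2
  have hi : IsIso ((toHo A).map (prod.fst : X ⨯ P ⟶ X)) :=
    Localization.inverts (toHo A) (weakEquivalences A) _ hw.mem
  have hf : ∀ a : X ⟶ P, prod.lift (𝟙 X) a ≫ prod.fst = 𝟙 X := fun a => prod.lift_fst _ _
  have hs : ∀ a : X ⟶ P, prod.lift (𝟙 X) a ≫ prod.snd = a := fun a => prod.lift_snd _ _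
  have key : (toHo A).map (prod.lift (𝟙 X) i) = (toHo A).map (prod.lift (𝟙 X) 0) := by
    rw [← cancel_mono ((toHo A).map (prod.fst : X ⨯ P ⟶ X)), ← Functor.map_comp,
      ← Functor.map_comp, hf, hf]
  have h1 : u + i ≫ s = prod.lift (𝟙 X) i ≫ (prod.fst ≫ u + prod.snd ≫ s) := by
    rw [Preadditive.comp_add, reassoc_of% hf, reassoc_of% hs]
  have h2 : u = prod.lift (𝟙 X) (0 : X ⟶ P) ≫ (prod.fst ≫ u + prod.snd ≫ s) := by
    rw [Preadditive.comp_add, reassoc_of% hf, reassoc_of% hs, zero_comp, add_zero]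
  rw [h1, Functor.map_comp, key, ← Functor.map_comp, ← h2]

lemma LoopData.Hom.unique {Y Z : A} {D : LoopData Y} {E : LoopData Z} {f : Y ⟶ Z}
    (φ ψ : D.Hom E f) : (toHo A).map φ.loop = (toHo A).map ψ.loop := by
  have sq : CommSq (0 : Y ⟶ E.P) D.r E.p (φ.f' - ψ.f') :=
    ⟨by rw [Preadditive.comp_sub, φ.wr, ψ.wr, sub_self, zero_comp]⟩
  let s : D.P ⟶ E.loop := kernel.lift E.p (φ.e - ψ.e - D.p ≫ sq.lift) (by
    simp [Preadditive.sub_comp, ← φ.wp, ← ψ.wp, Preadditive.comp_sub])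
  have hs : φ.loop = ψ.loop + kernel.ι D.p ≫ s := by
    rw [← cancel_mono (kernel.ι E.p), Preadditive.add_comp, φ.loop_ι, ψ.loop_ι, Category.assoc,
      kernel.lift_ι, Preadditive.comp_sub, Preadditive.comp_sub, kernel.condition_assoc, zero_comp]
    abel
  have := D.weq_to
  rw [hs, toHo_map_add]

lemma LoopData.exists_hom {Y Z : A} (D : LoopData Y) (E : LoopData Z) (f : Y ⟶ Z) :
    Nonempty (D.Hom E f) := by
  have sq : CommSq (f ≫ E.r) D.r (terminal.from E.Y') (terminal.from D.Y') :=
    ⟨Subsingleton.elim _ _⟩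
  have sq' : CommSq (initial.to E.P) (initial.to D.P) E.p (D.p ≫ sq.lift) :=
    ⟨Subsingleton.elim _ _⟩
  exact ⟨⟨sq.lift, sq'.lift, by simp, by simp⟩⟩

/-- A path fibration over any object. -/
lemma exists_path (Y : A) : ∃ (P : A) (p : P ⟶ Y), Fibration p ∧ IsCofibrant P ∧
    WeakEquivalence (initial.to P) := by
  have h := MorphismProperty.factorizationData (trivialCofibrations A) (fibrations A)
    (initial.to Y)
  have e : h.i = initial.to h.Z := Subsingleton.elim _ _
  obtain ⟨h1, h2⟩ := h.hi
  rw [e] at h1 h2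
  exact ⟨h.Z, h.p, ⟨h.hp⟩, ⟨h1⟩, ⟨h2⟩⟩

lemma exists_loopData (Y : A) : Nonempty (LoopData Y) := by
  have h := MorphismProperty.factorizationData (trivialCofibrations A) (fibrations A)
    (terminal.from Y)
  have e : h.p = terminal.from h.Z := Subsingleton.elim _ _
  have hp := h.hp
  rw [e] at hp
  obtain ⟨P, p, h1, h2, h3⟩ := exists_path h.Z
  exact ⟨⟨h.Z, P, h.i, p, ⟨h.hi.1⟩, ⟨h.hi.2⟩, ⟨hp⟩, h1, h2, h3⟩⟩

/-- A choice of fibrant replacement and path fibration. -/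
noncomputable def loopData (Y : A) : LoopData Y := (exists_loopData Y).some

variable (A) in
/-- The functor that sends `Y` to the image in the homotopy category of its loop object. -/
noncomputable def preLoop : A ⥤ Ho A where
  obj Y := (toHo A).obj (loopData Y).loop
  map {Y Z} f := (toHo A).map ((loopData Y).exists_hom (loopData Z) f).some.loop
  map_id Y := by
    rw [LoopData.Hom.unique _ (LoopData.Hom.id (loopData Y)), LoopData.Hom.loop_id,
      CategoryTheory.Functor.map_id]
  map_comp {X Y Z} f g := by
    rw [← Functor.map_comp, ← LoopData.Hom.loop_comp]
    exact LoopData.Hom.unique _ _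

lemma LoopData.Hom.isIso_of_id {Y : A} {D E : LoopData Y} (φ : D.Hom E (𝟙 Y)) :
    IsIso ((toHo A).map φ.loop) := by
  obtain ⟨ψ⟩ := E.exists_hom D (𝟙 Y)
  refine ⟨(toHo A).map ψ.loop, ?_, ?_⟩
  · rw [← Functor.map_comp, ← LoopData.Hom.loop_comp, ← CategoryTheory.Functor.map_id,
      ← LoopData.Hom.loop_id D]
    have h : 𝟙 Y ≫ 𝟙 Y = 𝟙 Y := Category.id_comp _
    exact LoopData.Hom.unique (f := 𝟙 Y ≫ 𝟙 Y) _ ⟨𝟙 _, 𝟙 _, by simp, by simp⟩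
  · rw [← Functor.map_comp, ← LoopData.Hom.loop_comp, ← CategoryTheory.Functor.map_id,
      ← LoopData.Hom.loop_id E]
    exact LoopData.Hom.unique (f := 𝟙 Y ≫ 𝟙 Y) _ ⟨𝟙 _, 𝟙 _, by simp, by simp⟩

/-- If one lift of `f` to loop data induces an isomorphism in the homotopy category, then so
does every lift. -/
lemma preLoop_isIso {Y Z : A} {f : Y ⟶ Z} {D : LoopData Y} {E : LoopData Z} (φ : D.Hom E f)
    (h : IsIso ((toHo A).map φ.loop)) : IsIso ((preLoop A).map f) := by
  obtain ⟨α⟩ := (loopData Y).exists_hom D (𝟙 Y)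
  obtain ⟨β⟩ := E.exists_hom (loopData Z) (𝟙 Z)
  have hα := α.isIso_of_id
  have hβ := β.isIso_of_id
  have e : (preLoop A).map f =
      (toHo A).map α.loop ≫ (toHo A).map φ.loop ≫ (toHo A).map β.loop := by
    rw [← Functor.map_comp, ← Functor.map_comp, ← LoopData.Hom.loop_comp,
      ← LoopData.Hom.loop_comp]
    have h : 𝟙 Y ≫ f ≫ 𝟙 Z = f := by simp
    let γ := α.comp (φ.comp β)
    exact LoopData.Hom.unique _ (⟨γ.f', γ.e, by rw [γ.wr, h], γ.wp⟩ : LoopData.Hom _ _ f)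
  rw [e]
  exact IsIso.comp_isIso' hα (IsIso.comp_isIso' h hβ)

lemma preLoop_inverts : (weakEquivalences A).IsInvertedBy (preLoop A) := by
  intro Y Z f hf
  have hf' : WeakEquivalence f := ⟨hf⟩
  let E := loopData Z
  -- a fibrant replacement `Y'` of `Y` with a trivial fibration to that of `Z`
  have h := MorphismProperty.factorizationData (trivialCofibrations A) (fibrations A) (f ≫ E.r)
  have : Cofibration h.i := ⟨h.hi.1⟩
  have : WeakEquivalence h.i := ⟨h.hi.2⟩
  have : Fibration h.p := ⟨h.hp⟩
  have hw : WeakEquivalence (f ≫ E.r) := inferInstance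
  have : WeakEquivalence h.p := weakEquivalence_of_precomp_of_fac h.fac
  have : IsFibrant h.Z := isFibrant_of_fibration h.p
  -- pull the path fibration back along it, and replace it cofibrantly
  have h' := MorphismProperty.factorizationData (cofibrations A) (trivialFibrations A)
    (initial.to (pullback h.p E.p))
  have e : h'.i = initial.to h'.Z := Subsingleton.elim _ _
  have hc := h'.hi
  rw [e] at hc
  have : IsCofibrant h'.Z := ⟨hc⟩
  have : Fibration h'.p := ⟨h'.hp.1⟩
  have : WeakEquivalence h'.p := ⟨h'.hp.2⟩
  have hsnd : trivialFibrations A (pullback.snd h.p E.p) :=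
    MorphismProperty.pullback_snd _ _ (mem_trivialFibrations h.p)
  have : WeakEquivalence (pullback.snd h.p E.p) := ⟨hsnd.2⟩
  have hw2 : WeakEquivalence (initial.to h'.Z) := by
    have e : initial.to h'.Z ≫ (h'.p ≫ pullback.snd h.p E.p) = initial.to E.P :=
      Subsingleton.elim _ _
    exact weakEquivalence_of_postcomp_of_fac e
  let D : LoopData Y :=
    { Y' := h.Z
      P := h'.Z
      r := h.i
      p := h'.p ≫ pullback.fst h.p E.p
      cof_r := inferInstance
      weq_r := inferInstance
      fib_Y' := inferInstance
      fib_p := inferInstance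
      cof_P := inferInstance
      weq_P := hw2 }
  let φ : D.Hom E f :=
    { f' := h.p
      e := h'.p ≫ pullback.snd h.p E.p
      wr := h.fac
      wp := by simp [D, pullback.condition] }
  refine preLoop_isIso φ (Localization.inverts (toHo A) (weakEquivalences A) _ ?_)
  -- the induced map of kernels is a base change of the trivial fibration `h'.p`
  let j : E.loop ⟶ pullback h.p E.p := pullback.lift 0 (kernel.ι E.p) (by simp)
  have hj₁ : j ≫ pullback.fst h.p E.p = 0 := pullback.lift_fst _ _ _
  have hj₂ : j ≫ pullback.snd h.p E.p = kernel.ι E.p := pullback.lift_snd _ _ _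
  have hD : kernel.ι D.p ≫ h'.p ≫ pullback.fst h.p E.p = 0 := kernel.condition D.p
  have hι : φ.loop ≫ kernel.ι E.p = kernel.ι D.p ≫ h'.p ≫ pullback.snd h.p E.p := φ.loop_ι
  have hpb : IsPullback φ.loop (kernel.ι D.p) j h'.p := by
    refine ⟨⟨?_⟩, ⟨PullbackCone.IsLimit.mk _ (fun s => kernel.lift D.p s.snd ?_) ?_ ?_ ?_⟩⟩
    · apply pullback.hom_ext
      · rw [Category.assoc, Category.assoc, hj₁, hD, comp_zero]
      · rw [Category.assoc, Category.assoc, hj₂, hι]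
    · have := s.condition =≫ pullback.fst h.p E.p
      rw [Category.assoc, Category.assoc, hj₁, comp_zero] at this
      exact this.symm
    · intro s
      have := s.condition =≫ pullback.snd h.p E.p
      rw [Category.assoc, Category.assoc, hj₂] at this
      rw [← cancel_mono (kernel.ι E.p), Category.assoc, hι, kernel.lift_ι_assoc]
      exact this.symm
    · intro s
      simp
    · intro s m _ hm
      rw [← cancel_mono (kernel.ι D.p), hm, kernel.lift_ι]
  exact (MorphismProperty.of_isPullback hpb.flip h'.hp).2

variable (A) in
/-- The loop functor `Ω : Ho A ⥤ Ho A`, induced by sending a fibrant object `Y` to the kernel of a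
fibration onto `Y` from a cofibrant weakly trivial object. -/
noncomputable def loopFunctor : Ho A ⥤ Ho A :=
  Localization.lift (preLoop A) preLoop_inverts (toHo A)

variable (A) in
/-- The iterates `Ωᵏ` of the loop functor. -/
noncomputable def iterLoop : ℕ → (Ho A ⥤ Ho A)
  | 0 => 𝟭 _
  | k + 1 => iterLoop k ⋙ loopFunctor A

/-- The map `Ho(X, Ωᵏ Y) → Ho(X, Ωᵏ Z)` induced by `f : Y ⟶ Z` is bijective for all `k ≥ 0`. -/
def LoopBijective (X : A) {Y Z : A} (f : Y ⟶ Z) : Prop :=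
  ∀ k : ℕ, Function.Bijective
    (fun g : (toHo A).obj X ⟶ (iterLoop A k).obj ((toHo A).obj Y) =>
      g ≫ (iterLoop A k).map ((toHo A).map f))

/-- The `K`-colocal equivalences, for a class `K` of objects. -/
def colocalEquivalences (K : ObjectProperty A) : MorphismProperty A :=
  fun _ _ f => ∀ X : A, K X → LoopBijective X f

/-- The `L`-colocal objects, for a class `L` of morphisms. -/
def colocalObjects (L : MorphismProperty A) : ObjectProperty A :=
  fun X => ∀ ⦃Y Z : A⦄ (f : Y ⟶ Z), L f → LoopBijective X f

end Loop

variable {A : Type u} [Category.{v} A] [Abelian A]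

/-- The model structure `N` is the right Bousfield localization of the model structure `M` with
respect to the class of morphisms `L`. -/
structure IsRightBousfieldLocalization (M N : ModelCategory A) (L : MorphismProperty A) :
    Prop where
  weakEquivalences_eq :
    (letI := N; weakEquivalences A) = (letI := M; colocalEquivalences (colocalObjects L))
  fibrations_eq : (letI := N; fibrations A) = (letI := M; fibrations A)
  cofibrations_eq : (letI := N; cofibrations A) = (letI := N; (trivialFibrations A).llp)

variable (A) in
/-- A model structure on an abelian category is abelian if the cofibrations are the monomorphisms
with cofibrant cokernel and the fibrations are the epimorphisms with fibrant kernel. -/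
structure AbelianModelStructure where
  model : ModelCategory A
  cofibration_iff : ∀ {X Y : A} (f : X ⟶ Y),
    Cofibration f ↔ Mono f ∧ IsCofibrant (cokernel f)
  fibration_iff : ∀ {X Y : A} (f : X ⟶ Y),
    Fibration f ↔ Epi f ∧ IsFibrant (kernel f)

namespace AbelianModelStructure

variable (M : AbelianModelStructure A)

/-- The class `C` of cofibrant objects. -/
def cofibrant : ObjectProperty A := fun X => letI := M.model; IsCofibrant X

/-- The class `W` of weakly trivial objects. -/
def trivial : ObjectProperty A := fun X => letI := M.model; WeakEquivalence (initial.to X)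

/-- The class `F` of fibrant objects. -/
def fibrant : ObjectProperty A := fun X => letI := M.model; IsFibrant X

/-- An abelian model structure is injective if every object is cofibrant. -/
def IsInjective : Prop := ∀ X : A, M.cofibrant X

end AbelianModelStructure

/-- Closed under kernels of epimorphisms. -/
def IsResolving (D : ObjectProperty A) : Prop :=
  ∀ S : ShortComplex A, S.ShortExact → D S.X₂ → D S.X₃ → D S.X₁

/-- Closed under cokernels of monomorphisms. -/
def IsCoresolving (D : ObjectProperty A) : Prop :=
  ∀ S : ShortComplex A, S.ShortExact → D S.X₁ → D S.X₂ → D S.X₃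

/-- An abelian model structure is hereditary if both of its cotorsion pairs `(C, W ∩ F)` and
`(C ∩ W, F)` are hereditary. -/
structure AbelianModelStructure.IsHereditary (M : AbelianModelStructure A) : Prop where
  resolving : IsResolving M.cofibrant
  coresolving : IsCoresolving (M.trivial ⊓ M.fibrant)
  resolving' : IsResolving (M.cofibrant ⊓ M.trivial)
  coresolving' : IsCoresolving M.fibrant

/-- `M` is the right localization `M₁/M₂`: the hereditary abelian model structure whose cofibrant
objects are the weakly trivial objects of `M₂`, whose fibrant objects are those of `M₁`, and whose
weakly trivial objects are the `X` that fit into an exact sequence `0 ⟶ X ⟶ F ⟶ W ⟶ 0` with `F`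
fibrant in `M₂` and `W` weakly trivial in `M₁`. -/
structure IsRightLocalization (M₁ M₂ M : AbelianModelStructure A) : Prop where
  hereditary : M.IsHereditary
  cofibrant_iff : ∀ X : A, M.cofibrant X ↔ M₂.trivial X
  fibrant_iff : ∀ X : A, M.fibrant X ↔ M₁.fibrant X
  trivial_iff : ∀ X : A, M.trivial X ↔
    ∃ (F W : A) (i : X ⟶ F) (p : F ⟶ W) (w : i ≫ p = 0),
      (ShortComplex.mk i p w).ShortExact ∧ M₂.fibrant F ∧ M₁.trivial W

/-- The class of morphisms `{0 ⟶ X | X ∈ K}`. -/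
def zeroMapsTo (K : ObjectProperty A) : MorphismProperty A :=
  MorphismProperty.ofHoms (fun X : {X : A // K X} => (0 : (0 : A) ⟶ X.1))

end AbelianModel

/-!
# Right localization of injective abelian model structures

For injective abelian model structures `M₁`, `M₂` with `F₂ ⊆ F₁`, let `fibᵢ` be the fibrations and
`tcofᵢ` the trivial cofibrations of `Mᵢ`, so that `fib₂ ⊆ fib₁` and `tcof₁ ⊆ tcof₂`. The model
structure `M₁/M₂` has the cofibrations `tcof₂` and the fibrations `fib₁`. Both weak factorization
systems `(tcof₂, fib₂)` and `(tcof₁, fib₁)` are at hand, and only a class of weak equivalences `W`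
with the two-out-of-three property is missing such that `fib₁ ∩ W = fib₂` and `tcof₂ ∩ W = tcof₁`.
The colocal equivalences of `M₁` are taken for `W`: two-out-of-three is then obvious, and the
comparison with the right Bousfield localization amounts to the fact that cofibrations and
fibrations determine the weak equivalences. The second equality follows from the first by the retract argument.

Maps to a fibrant object in the homotopy category of an injective abelian model structure are maps
modulo those that factor through injective objects (`toHo_map_eq_iff`). It follows that the colocal
objects are the weakly trivial objects of `M₂` (`colocalObjects_zeroMapsTo`), and the equality
`fib₁ ∩ W = fib₂` has two halves.

* A fibration `p` of `M₂` is a colocal equivalence (`loopBijective_of_fib`). A pushout along a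
  fibrant replacement makes the source and the target fibrant in `M₁` without changing the kernel
  (`exists_fibrant_square`); then the bijectivity on maps from a weakly trivial object of `M₂` is a
  lifting argument, and the loop functor of `M₁` takes `p` to a fibration of `M₂` again
  (`exists_loop_fib`).
* A fibration `p` of `M₁` that is a colocal equivalence is a fibration of `M₂`
  (`fib_of_loopBijective`). Its kernel `K` is a cokernel of the map of loop objects, for a suitable
  choice of these; so every map to `K` from a weakly trivial object of `M₂` factors through an
  injective object (`exists_factor_injective`). Hence such maps extend along monomorphisms, and this
  suffices for `K` to be fibrant in `M₂` (`fibrant_of_exists_extension`).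

The same extension criterion shows that injective abelian model structures are hereditary.
-/

namespace AbelianModel

variable {A : Type u} [Category.{v} A] [Abelian A]

/-! ### Bicartesian squares in abelian categories -/

/-- If `j` and `j ≫ p` are monomorphisms and `p` is an epimorphism, then `p` is the base change of
the map that it induces between the cokernels of `j` and `j ≫ p`. -/
lemma isPullback_cokernel_map {X Y Z : A} (j : X ⟶ Z) (p : Z ⟶ Y) [Mono (j ≫ p)] [Epi p] :
    IsPullback (cokernel.π j) p (cokernel.map j (j ≫ p) (𝟙 X) p (by simp))
      (cokernel.π (j ≫ p)) := by
  have sq : CommSq (cokernel.π j) p (cokernel.map j (j ≫ p) (𝟙 X) p (by simp))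
      (cokernel.π (j ≫ p)) := ⟨by simp⟩
  let l := pullback.lift _ _ sq.w
  have hl₁ : l ≫ pullback.fst _ _ = cokernel.π j := pullback.lift_fst _ _ _
  have hl₂ : l ≫ pullback.snd _ _ = p := pullback.lift_snd _ _ _
  have hj := ShortComplex.exact_of_g_is_cokernel (.mk j _ (cokernel.condition j))
    (cokernelIsCokernel j)
  have hjp := ShortComplex.exact_of_g_is_cokernel (.mk (j ≫ p) _ (cokernel.condition (j ≫ p)))
    (cokernelIsCokernel (j ≫ p))
  have : Mono l := by
    refine Preadditive.mono_of_cancel_zero _ fun {T} x hx => ?_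
    have h₁ : x ≫ cokernel.π j = 0 := by rw [← hl₁, reassoc_of% hx, zero_comp]
    have h₂ : x ≫ p = 0 := by rw [← hl₂, reassoc_of% hx, zero_comp]
    obtain ⟨T', π, _, y, hy⟩ := hj.exact_up_to_refinements x h₁
    have : y = 0 := by
      rw [← cancel_mono (j ≫ p), ← Category.assoc]
      dsimp at hy
      rw [← hy, Category.assoc, h₂, comp_zero, zero_comp]
    rw [← cancel_epi π, hy, this, zero_comp, comp_zero]
  have : Epi l := by
    rw [epi_iff_surjective_up_to_refinements]
    intro T y
    obtain ⟨T₁, π₁, _, x, hx⟩ := surjective_up_to_refinements_of_epi (cokernel.π j)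
      (y ≫ pullback.fst _ _)
    obtain ⟨T₂, π₂, _, z, hz⟩ := hjp.exact_up_to_refinements
      (π₁ ≫ y ≫ pullback.snd _ _ - x ≫ p) (by
      have := hx =≫ cokernel.map j (j ≫ p) (𝟙 X) p (by simp)
      simp only [Category.assoc, pullback.condition, cokernel.π_desc] at this
      simp [Preadditive.sub_comp, this])
    refine ⟨T₂, π₂ ≫ π₁, inferInstance, π₂ ≫ x + z ≫ j, ?_⟩
    apply pullback.hom_ext
    · simp [Category.assoc, hl₁, hx]
    · dsimp at hz
      rw [Category.assoc, Category.assoc, Category.assoc, hl₂,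
        Preadditive.add_comp, Category.assoc, Category.assoc, ← hz, Preadditive.comp_sub]
      abel
  have : IsIso l := isIso_of_mono_of_epi l
  exact IsPullback.of_iso_pullback sq (asIso l) hl₁ hl₂

/-- The base change `i` of a monomorphism `j` along an epimorphism has the same cokernel. -/
lemma shortExact_of_isPullback {T U V Z : A} {i : T ⟶ Z} {t : T ⟶ U} {q : Z ⟶ V} {j : U ⟶ V}
    (h : IsPullback i t q j) [Epi q] [Mono j] :
    (ShortComplex.mk i (q ≫ cokernel.π j) (by simp [reassoc_of% h.w])).ShortExact := by
  have : Mono i := h.mono_fst_of_mono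
  refine ⟨ShortComplex.exact_of_f_is_kernel _ ?_⟩
  refine KernelFork.IsLimit.ofι' _ _ fun {W} k hk => ?_
  refine ⟨h.lift k (Abelian.monoLift j (k ≫ q) (by simpa using hk)) ?_, h.lift_fst _ _ _⟩
  rw [Abelian.monoLift_comp]

/-- A monomorphism `j` out of the source of an epimorphism `p` yields a short exact sequence that
starts with the kernel of `p` and ends with the pushout of `p` along `j`. -/
lemma shortExact_pushout {X Y Z : A} (p : X ⟶ Y) [Epi p] (j : X ⟶ Z) [Mono j] :
    (ShortComplex.mk (kernel.ι p ≫ j) (pushout.inr p j)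
      (by rw [Category.assoc, ← pushout.condition, kernel.condition_assoc,
        zero_comp])).ShortExact := by
  refine ⟨ShortComplex.exact_of_g_is_cokernel _ ?_⟩
  refine CokernelCofork.IsColimit.ofπ' _ _ fun {W} k hk => ?_
  exact ⟨pushout.desc (Abelian.epiDesc p (j ≫ k) (by simpa using hk)) k
    (by rw [Abelian.comp_epiDesc]), pushout.inr_desc _ _ _⟩

/-! ### Injective abelian model structures -/

namespace AbelianModelStructure

variable (M : AbelianModelStructure A)

/-- The class of fibrations. -/
def fib : MorphismProperty A := letI := M.model; fibrations A

/-- The class of trivial cofibrations. -/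
def tcof : MorphismProperty A := letI := M.model; trivialCofibrations A

instance : MorphismProperty.IsWeakFactorizationSystem M.tcof M.fib :=
  let := M.model
  inferInstanceAs
    (MorphismProperty.IsWeakFactorizationSystem (trivialCofibrations A) (fibrations A))

instance : M.fib.IsMultiplicative :=
  letI := M.model; inferInstanceAs (fibrations A).IsMultiplicative

instance : M.fib.IsStableUnderBaseChange :=
  letI := M.model; inferInstanceAs (fibrations A).IsStableUnderBaseChange

instance : M.tcof.IsMultiplicative :=
  letI := M.model; inferInstanceAs (trivialCofibrations A).IsMultiplicative

instance : M.tcof.IsStableUnderCobaseChange :=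
  letI := M.model; inferInstanceAs (trivialCofibrations A).IsStableUnderCobaseChange

instance : M.tcof.IsStableUnderRetracts := by
  rw [← MorphismProperty.llp_eq_of_wfs M.tcof M.fib]; infer_instance

variable {M}

lemma fib_iff {X Y : A} (p : X ⟶ Y) : M.fib p ↔ Epi p ∧ M.fibrant (kernel p) := by
  let := M.model
  exact (HomotopicalAlgebra.fibration_iff p).symm.trans (M.fibration_iff p)

lemma fib.epi {X Y : A} {p : X ⟶ Y} (h : M.fib p) : Epi p := ((fib_iff p).1 h).1

lemma fibrant_iff_of_isZero {X Z : A} (p : X ⟶ Z) (hZ : IsZero Z) : M.fibrant X ↔ M.fib p := by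
  let := M.model
  exact (isFibrant_iff_of_isTerminal p hZ.isTerminal).trans (HomotopicalAlgebra.fibration_iff p)

lemma fibrant_of_fib {X Y : A} {p : X ⟶ Y} (h : M.fib p) (hY : M.fibrant Y) : M.fibrant X := by
  rw [fibrant_iff_of_isZero (0 : _ ⟶ (0 : A)) (isZero_zero A)] at hY ⊢
  simpa using M.fib.comp_mem _ _ h hY

lemma fibrant_of_iso {X Y : A} (e : X ≅ Y) (hY : M.fibrant Y) : M.fibrant X :=
  fibrant_of_fib (M.fib.of_isIso e.hom) hY

lemma fibrant_of_isZero {Z : A} (hZ : IsZero Z) : M.fibrant Z :=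
  (fibrant_iff_of_isZero (𝟙 Z) hZ).2 (M.fib.id_mem Z)

lemma fib_g_iff {S : ShortComplex A} (hS : S.ShortExact) : M.fib S.g ↔ M.fibrant S.X₁ := by
  have := hS.epi_g
  let e : S.X₁ ≅ kernel S.g := IsLimit.conePointUniqueUpToIso hS.fIsKernel (limit.isLimit _)
  rw [fib_iff]
  exact ⟨fun h => fibrant_of_iso e h.2, fun h => ⟨this, fibrant_of_iso e.symm h⟩⟩

lemma exists_lift {U V X Y : A} {j : U ⟶ V} (hj : M.tcof j) {p : X ⟶ Y} (hp : M.fib p)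
    (a : U ⟶ X) (b : V ⟶ Y) (w : a ≫ p = j ≫ b) : ∃ l : V ⟶ X, j ≫ l = a ∧ l ≫ p = b := by
  have := MorphismProperty.hasLiftingProperty_of_wfs j p hj hp
  have sq : CommSq a j p b := ⟨w⟩
  exact ⟨sq.lift, sq.fac_left, sq.fac_right⟩

lemma exists_extension {U V X : A} {j : U ⟶ V} (hj : M.tcof j) (hX : M.fibrant X) (a : U ⟶ X) :
    ∃ l : V ⟶ X, j ≫ l = a := by
  obtain ⟨l, h, -⟩ := exists_lift hj
    ((fibrant_iff_of_isZero (0 : X ⟶ 0) (isZero_zero A)).1 hX) a 0 (by simp)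
  exact ⟨l, h⟩

lemma trivial_iff_tcof (hM : M.IsInjective) {X : A} : M.trivial X ↔ M.tcof (initial.to X) := by
  let := M.model
  exact ⟨fun h => (mem_trivialCofibrations_iff _).2 ⟨hM X, h⟩,
    fun h => ((mem_trivialCofibrations_iff _).1 h).2⟩

/-- The weakly trivial objects are those that are projective relative to the fibrations. -/
lemma trivial_iff_exists_lift (hM : M.IsInjective) {X : A} :
    M.trivial X ↔ ∀ ⦃E B : A⦄ (p : E ⟶ B), M.fib p → ∀ b : X ⟶ B, ∃ l : X ⟶ E, l ≫ p = b := by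
  rw [trivial_iff_tcof hM]
  constructor
  · intro h E B p hp b
    obtain ⟨l, -, hl⟩ := exists_lift h hp (initial.to E) b (Subsingleton.elim _ _)
    exact ⟨l, hl⟩
  · intro h
    rw [← MorphismProperty.llp_eq_of_wfs M.tcof M.fib]
    refine fun E B p hp => ⟨fun {a b} sq => ?_⟩
    obtain ⟨l, hl⟩ := h p hp b
    exact ⟨⟨l, Subsingleton.elim _ _, hl⟩⟩

lemma cofibration_iff_mono (hM : M.IsInjective) {X Y : A} (f : X ⟶ Y) :
    (letI := M.model; Cofibration f) ↔ Mono f := by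
  let := M.model
  exact (M.cofibration_iff f).trans (and_iff_left (hM _))

lemma tcof.mono (hM : M.IsInjective) {X Y : A} {f : X ⟶ Y} (h : M.tcof f) : Mono f := by
  let := M.model
  exact (cofibration_iff_mono hM f).1 ((mem_trivialCofibrations_iff _).1 h).1

lemma trivial_cokernel (hM : M.IsInjective) {X Y : A} {f : X ⟶ Y} (h : M.tcof f) :
    M.trivial (cokernel f) := by
  rw [trivial_iff_exists_lift hM]
  intro E B p hp b
  obtain ⟨l, hl, hl'⟩ := exists_lift h hp 0 (cokernel.π f ≫ b) (by simp)
  refine ⟨cokernel.desc f l hl, ?_⟩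
  rw [← cancel_epi (cokernel.π f), cokernel.π_desc_assoc, hl']

lemma trivial_X₃ (hM : M.IsInjective) {S : ShortComplex A} (hS : S.ShortExact)
    (h : M.tcof S.f) : M.trivial S.X₃ := by
  have := trivial_cokernel hM h
  rw [trivial_iff_exists_lift hM] at this ⊢
  intro E B p hp b
  let e : S.X₃ ≅ cokernel S.f :=
    IsColimit.coconePointUniqueUpToIso hS.gIsCokernel (colimit.isColimit _)
  obtain ⟨l, hl⟩ := this p hp (e.inv ≫ b)
  exact ⟨e.hom ≫ l, by simp [hl]⟩

lemma trivial_of_iso (hM : M.IsInjective) {X Y : A} (e : X ≅ Y) (hY : M.trivial Y) :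
    M.trivial X := by
  rw [trivial_iff_exists_lift hM] at hY ⊢
  intro E B p hp b
  obtain ⟨l, hl⟩ := hY p hp (e.inv ≫ b)
  exact ⟨e.hom ≫ l, by simp [hl]⟩

/-- A monomorphism with weakly trivial cokernel is a trivial cofibration. In a factorization of it
into a trivial cofibration and a fibration `p`, the latter is a base change of the fibration that
it induces on cokernels, and that one is a weak equivalence between weakly trivial objects. -/
lemma tcof_of_trivial_cokernel (hM : M.IsInjective) {X Y : A} (f : X ⟶ Y) [Mono f]
    (h : M.trivial (cokernel f)) : M.tcof f := by
  let := M.model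
  let d := MorphismProperty.factorizationData (trivialCofibrations A) (fibrations A) f
  have : Cofibration d.i := ⟨d.hi.1⟩
  have : WeakEquivalence d.i := ⟨d.hi.2⟩
  have : Fibration d.p := ⟨d.hp⟩
  obtain ⟨_, hker⟩ := (M.fibration_iff d.p).1 inferInstance
  have : Mono (d.i ≫ d.p) := by rw [d.fac]; infer_instance
  have sq := isPullback_cokernel_map d.i d.p
  let c := cokernel.map d.i (d.i ≫ d.p) (𝟙 X) d.p (by simp)
  have hsq : cokernel.π d.i ≫ c = d.p ≫ cokernel.π (d.i ≫ d.p) := sq.w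
  have : Epi c := by
    have : Epi (cokernel.π d.i ≫ c) := by rw [hsq]; infer_instance
    exact epi_of_epi (cokernel.π d.i) c
  have : IsIso (kernel.map d.p c _ _ hsq.symm) :=
    isIso_kernel_map_of_isPullback sq.flip
  have hc : Fibration c := (M.fibration_iff c).2
    ⟨inferInstance, fibrant_of_iso (asIso (kernel.map d.p c _ _ hsq.symm)).symm hker⟩
  have h₁ : WeakEquivalence (initial.to (cokernel d.i)) := trivial_cokernel hM d.hi
  have h₂ : WeakEquivalence (initial.to (cokernel (d.i ≫ d.p))) :=
    trivial_of_iso hM (cokernelIsoOfEq d.fac) h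
  have : WeakEquivalence c :=
    weakEquivalence_of_precomp_of_fac
      (show initial.to _ ≫ c = initial.to _ from Subsingleton.elim _ _)
  have hp : trivialFibrations A d.p :=
    MorphismProperty.of_isPullback sq (mem_trivialFibrations c)
  have : WeakEquivalence d.p := ⟨hp.2⟩
  have hf : WeakEquivalence f := by rw [← d.fac]; infer_instance
  exact (mem_trivialCofibrations_iff _).2 ⟨(cofibration_iff_mono hM f).2 inferInstance, hf⟩

lemma tcof_iff (hM : M.IsInjective) {X Y : A} (f : X ⟶ Y) :
    M.tcof f ↔ Mono f ∧ M.trivial (cokernel f) :=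
  ⟨fun h => ⟨h.mono hM, trivial_cokernel hM h⟩, fun ⟨_, h⟩ => tcof_of_trivial_cokernel hM f h⟩

lemma tcof_f_iff (hM : M.IsInjective) {S : ShortComplex A} (hS : S.ShortExact) :
    M.tcof S.f ↔ M.trivial S.X₃ := by
  refine ⟨trivial_X₃ hM hS, fun h => ?_⟩
  have := hS.mono_f
  exact tcof_of_trivial_cokernel hM _ (trivial_of_iso hM
    (IsColimit.coconePointUniqueUpToIso (colimit.isColimit _) hS.gIsCokernel) h)

lemma resolving_trivial (hM : M.IsInjective) : IsResolving M.trivial := by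
  intro S hS h₂ h₃
  let := M.model
  have := (mem_trivialCofibrations_iff _).1 ((tcof_f_iff hM hS).2 h₃)
  have := this.2
  have : WeakEquivalence (initial.to S.X₂) := h₂
  exact weakEquivalence_of_postcomp_of_fac
    (show initial.to S.X₁ ≫ S.f = initial.to S.X₂ from Subsingleton.elim _ _)

lemma coresolving_trivial (hM : M.IsInjective) : IsCoresolving M.trivial := by
  intro S hS h₁ h₂
  rw [← tcof_f_iff hM hS]
  let := M.model
  have : WeakEquivalence (initial.to S.X₁) := h₁
  have : WeakEquivalence (initial.to S.X₂) := h₂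
  refine (mem_trivialCofibrations_iff _).2 ⟨(cofibration_iff_mono hM _).2 hS.mono_f, ?_⟩
  exact weakEquivalence_of_precomp_of_fac
    (show initial.to S.X₁ ≫ S.f = initial.to S.X₂ from Subsingleton.elim _ _)

/-- An object is injective if and only if it is weakly trivial and fibrant. -/
lemma injective_iff (hM : M.IsInjective) {X : A} :
    Injective X ↔ M.trivial X ∧ M.fibrant X := by
  let := M.model
  have hmono : cofibrations A = MorphismProperty.monomorphisms A := by
    ext X Y f
    exact (HomotopicalAlgebra.cofibration_iff f).symm.trans (cofibration_iff_mono hM f)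
  have hw : WeakEquivalence (initial.to X) ↔ WeakEquivalence (terminal.from X) := by
    have : IsIso (initial.to X ≫ terminal.from X) :=
      ⟨0, (initialIsInitial (C := A)).hom_ext _ _, (terminalIsTerminal (C := A)).hom_ext _ _⟩
    have : WeakEquivalence (initial.to X ≫ terminal.from X) := inferInstance
    exact ⟨fun _ => weakEquivalence_of_precomp (initial.to X) _,
      fun _ => weakEquivalence_of_postcomp _ (terminal.from X)⟩
  rw [injective_iff_rlp_monomorphisms_of_isZero (terminal.from X)
      ((isZero_zero A).of_iso (HasZeroObject.zeroIsoTerminal).symm), ← hmono, cofibrations_rlp,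
    mem_trivialFibrations_iff, ← hw, and_comm]
  rfl

lemma enoughInjectives (hM : M.IsInjective) : EnoughInjectives A := by
  refine ⟨fun X => ⟨?_⟩⟩
  let := M.model
  let d := MorphismProperty.factorizationData (cofibrations A) (trivialFibrations A)
    (0 : X ⟶ 0)
  have : Fibration d.p := ⟨d.hp.1⟩
  have : WeakEquivalence d.p := ⟨d.hp.2⟩
  have : Cofibration d.i := ⟨d.hi⟩
  refine ⟨d.Z, (injective_iff_rlp_monomorphisms_of_isZero d.p (isZero_zero A)).2 ?_, d.i,
    (cofibration_iff_mono hM _).1 inferInstance⟩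
  intro U V i hi
  have : Cofibration i := (cofibration_iff_mono hM i).2 hi
  infer_instance

lemma trivial_of_injective (hM : M.IsInjective) (X : A) [hX : Injective X] : M.trivial X :=
  ((injective_iff hM).1 hX).1

lemma fibrant_of_injective (hM : M.IsInjective) (X : A) [hX : Injective X] : M.fibrant X :=
  ((injective_iff hM).1 hX).2

lemma exists_fibrantReplacement (M : AbelianModelStructure A) (X : A) :
    ∃ (R : A) (j : X ⟶ R), M.tcof j ∧ M.fibrant R := by
  let d := MorphismProperty.factorizationData M.tcof M.fib (0 : X ⟶ 0)
  exact ⟨d.Z, d.i, d.hi, (fibrant_iff_of_isZero d.p (isZero_zero A)).2 d.hp⟩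

/-- Every object is the target of a fibration whose source is weakly trivial. -/
lemma exists_fib_of_trivial (hM : M.IsInjective) (X : A) :
    ∃ (P : A) (p : P ⟶ X), M.fib p ∧ M.trivial P := by
  let d := MorphismProperty.factorizationData M.tcof M.fib (initial.to X)
  refine ⟨d.Z, d.p, d.hp, (trivial_iff_tcof hM).2 ?_⟩
  rw [Subsingleton.elim (initial.to d.Z) d.i]
  exact d.hi

/-- To prove that `K` is fibrant, it suffices to extend maps to `K` along monomorphisms whose
source is weakly trivial and whose target belongs to a class `Z` of weakly trivial objects that
covers `A`. -/
lemma fibrant_of_exists_extension (hM : M.IsInjective) (Z : ObjectProperty A)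
    (hZ : Z ≤ M.trivial) (hcov : ∀ X : A, ∃ (P : A) (q : P ⟶ X), Epi q ∧ Z P) (K : A)
    (hK : ∀ ⦃T P : A⦄ (i : T ⟶ P), M.tcof i → M.trivial T → Z P →
      ∀ a : T ⟶ K, ∃ l : P ⟶ K, i ≫ l = a) : M.fibrant K := by
  rw [fibrant_iff_of_isZero (0 : K ⟶ 0) (isZero_zero A),
    ← MorphismProperty.rlp_eq_of_wfs M.tcof M.fib]
  refine fun U V j hj => ⟨fun {a b} sq => ?_⟩
  have := hj.mono hM
  obtain ⟨P, q, _, hP⟩ := hcov V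
  have hpb := IsPullback.of_hasPullback q j
  have hS := shortExact_of_isPullback hpb
  have hW := trivial_cokernel hM hj
  obtain ⟨h, hh⟩ := hK (pullback.fst q j) ((tcof_f_iff hM hS).2 hW)
    (resolving_trivial hM _ hS (hZ _ hP) hW) hP (pullback.snd q j ≫ a)
  have hker : kernel.ι q ≫ h = 0 := by
    have e : kernel.ι q =
        pullback.lift (kernel.ι q) 0 (by rw [kernel.condition, zero_comp]) ≫ pullback.fst q j :=
      (pullback.lift_fst _ _ _).symm
    rw [e, Category.assoc, hh, pullback.lift_snd_assoc, zero_comp]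
  refine ⟨⟨Abelian.epiDesc q h hker, ?_, (isZero_zero A).eq_of_tgt _ _⟩⟩
  rw [← cancel_epi (pullback.snd q j), ← pullback.condition_assoc, Abelian.comp_epiDesc, hh]

/-- Let `X₁ ⟶ X₂ ⟶ X₃` be short exact with `X₁` and `X₂` fibrant. A map to `X₃` from a weakly
trivial object lifts to `X₂`, and there it extends along trivial cofibrations. -/
lemma coresolving_fibrant (hM : M.IsInjective) : IsCoresolving M.fibrant := by
  intro S hS h₁ h₂
  have hg := (fib_g_iff hS).2 h₁
  refine fibrant_of_exists_extension hM M.trivial le_rfl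
    (fun X => ?_) _ fun T P i hi hT hP a => ?_
  · obtain ⟨P, p, hp, hP⟩ := exists_fib_of_trivial hM X
    exact ⟨P, p, hp.epi, hP⟩
  · obtain ⟨b, rfl⟩ := (trivial_iff_exists_lift hM).1 hT _ hg a
    obtain ⟨l, rfl⟩ := exists_extension hi h₂ b
    exact ⟨l ≫ S.g, (Category.assoc _ _ _).symm⟩

end AbelianModelStructure

end AbelianModel

namespace AbelianModel

/-! ### Loop functor and colocal equivalences -/

lemma bijective_comp_of_arrow_iso {C : Type*} [Category C] {Y Z Y' Z' : C} {f : Y ⟶ Z}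
    {g : Y' ⟶ Z'} (e : Arrow.mk f ≅ Arrow.mk g) (T : C)
    (h : Function.Bijective (fun a : T ⟶ Y' => a ≫ g)) :
    Function.Bijective (fun a : T ⟶ Y => a ≫ f) := by
  have hw : e.hom.left ≫ g = f ≫ e.hom.right := Arrow.w e.hom
  let eY : (T ⟶ Y) ≃ (T ⟶ Y') := (Arrow.leftFunc.mapIso e).homToEquiv
  let eZ : (T ⟶ Z) ≃ (T ⟶ Z') := (Arrow.rightFunc.mapIso e).homToEquiv
  have : eZ ∘ (fun a : T ⟶ Y => a ≫ f) = (fun a : T ⟶ Y' => a ≫ g) ∘ eY := by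
    ext a
    change (a ≫ f) ≫ e.hom.right = (a ≫ e.hom.left) ≫ g
    rw [Category.assoc, Category.assoc, hw]
  rw [← eZ.comp_bijective, this]
  exact h.comp eY.bijective

variable {A : Type u} [Category.{v} A] [Abelian A]

section

variable [ModelCategory A]

/-- The loop functor can be computed on `f` by any lift of `f` to loop data. -/
lemma loopFunctor_map_arrow_iso {Y Z : A} {f : Y ⟶ Z} {D : LoopData Y} {E : LoopData Z}
    (φ : D.Hom E f) : Nonempty
      (Arrow.mk ((loopFunctor A).map ((toHo A).map f)) ≅ Arrow.mk ((toHo A).map φ.loop)) := by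
  obtain ⟨α⟩ := (loopData Y).exists_hom D (𝟙 Y)
  obtain ⟨β⟩ := E.exists_hom (loopData Z) (𝟙 Z)
  have hα := α.isIso_of_id
  have hβ := β.isIso_of_id
  have e : (preLoop A).map f =
      (toHo A).map α.loop ≫ (toHo A).map φ.loop ≫ (toHo A).map β.loop := by
    rw [← Functor.map_comp, ← Functor.map_comp, ← LoopData.Hom.loop_comp,
      ← LoopData.Hom.loop_comp]
    have h : 𝟙 Y ≫ f ≫ 𝟙 Z = f := by simp
    let γ := α.comp (φ.comp β)
    exact LoopData.Hom.unique _ (⟨γ.f', γ.e, by rw [γ.wr, h], γ.wp⟩ : LoopData.Hom _ _ f)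
  let fac : toHo A ⋙ loopFunctor A ≅ preLoop A := Localization.fac _ preLoop_inverts _
  let e₁ : Arrow.mk ((loopFunctor A).map ((toHo A).map f)) ≅ Arrow.mk ((preLoop A).map f) :=
    Arrow.isoMk (fac.app Y) (fac.app Z) (fac.hom.naturality f).symm
  let b : (toHo A).obj E.loop ≅ (toHo A).obj (loopData Z).loop := @asIso _ _ _ _ _ hβ
  have hb : (toHo A).map β.loop ≫ b.inv = 𝟙 _ := b.hom_inv_id
  have hc : (toHo A).map α.loop ≫ (toHo A).map φ.loop =
      ((toHo A).map α.loop ≫ (toHo A).map φ.loop ≫ (toHo A).map β.loop) ≫ b.inv := by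
    rw [Category.assoc, Category.assoc, hb, Category.comp_id]
  let e₂ : Arrow.mk ((preLoop A).map f) ≅ Arrow.mk ((toHo A).map φ.loop) :=
    Arrow.isoMk (@asIso _ _ _ _ _ hα) b.symm (hc.trans (congrArg (· ≫ b.inv) e.symm))
  exact ⟨e₁ ≪≫ e₂⟩

lemma LoopBijective.of_weakEquivalence (X : A) {Y Z : A} (f : Y ⟶ Z) [WeakEquivalence f] :
    LoopBijective X f := by
  intro k
  have : IsIso ((toHo A).map f) :=
    Localization.inverts (toHo A) (weakEquivalences A) f (mem_weakEquivalences f)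
  exact (asIso ((iterLoop A k).map ((toHo A).map f))).homToEquiv.bijective

lemma loopBijective_comp_fun (X : A) {Y Z W : A} (f : Y ⟶ Z) (g : Z ⟶ W) (k : ℕ) :
    (fun a : (toHo A).obj X ⟶ (iterLoop A k).obj ((toHo A).obj Y) =>
      a ≫ (iterLoop A k).map ((toHo A).map (f ≫ g))) =
    (fun a => a ≫ (iterLoop A k).map ((toHo A).map g)) ∘
      (fun a => a ≫ (iterLoop A k).map ((toHo A).map f)) := by
  ext a
  simp

namespace LoopBijective

variable {X Y Z W : A} {f : Y ⟶ Z} {g : Z ⟶ W}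

lemma comp (hf : LoopBijective X f) (hg : LoopBijective X g) : LoopBijective X (f ≫ g) := by
  intro k
  rw [loopBijective_comp_fun]
  exact (hg k).comp (hf k)

lemma of_precomp (hf : LoopBijective X f) (h : LoopBijective X (f ≫ g)) : LoopBijective X g := by
  intro k
  have := h k
  rw [loopBijective_comp_fun] at this
  exact (Function.Bijective.of_comp_iff _ (hf k)).1 this

lemma of_postcomp (hg : LoopBijective X g) (h : LoopBijective X (f ≫ g)) :
    LoopBijective X f := by
  intro k
  have := h k
  rw [loopBijective_comp_fun] at this
  exact (Function.Bijective.of_comp_iff' (hg k) _).1 this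

end LoopBijective

instance (K : ObjectProperty A) : (colocalEquivalences K).HasTwoOutOfThreeProperty where
  comp_mem _ _ hf hg X hX := (hf X hX).comp (hg X hX)
  of_postcomp _ _ hg h X hX := (hg X hX).of_postcomp (h X hX)
  of_precomp _ _ hf h X hX := (hf X hX).of_precomp (h X hX)

end

namespace AbelianModelStructure

/-! ### Morphisms in the homotopy category -/

variable {M M₁ M₂ : AbelianModelStructure A}

lemma toHo_map_surjective (hM : M.IsInjective) (X : A) {Y : A} (hY : M.fibrant Y) :
    letI := M.model
    Function.Surjective ((toHo A).map : (X ⟶ Y) → _) := by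
  let := M.model
  have : IsCofibrant X := hM X
  have : IsFibrant Y := hY
  exact map_surjective_of_isLocalization (toHo A) X Y

/-- Two maps to a fibrant object become equal in the homotopy category if and only if they differ
by a map that factors through an injective object. -/
lemma toHo_map_eq_iff (hM : M.IsInjective) {X Y : A} (hY : M.fibrant Y) (f g : X ⟶ Y) :
    (letI := M.model; (toHo A).map f = (toHo A).map g) ↔
      ∃ (I : A) (_ : Injective I) (i : X ⟶ I) (s : I ⟶ Y), f = g + i ≫ s := by
  let := M.model
  have : IsCofibrant X := hM X
  have : IsFibrant Y := hY
  have := enoughInjectives hM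
  constructor
  · intro h
    -- the two projections of a path object agree on `Y`, so that their difference factors through
    -- the weakly trivial cokernel of the inclusion of `Y`
    obtain ⟨P, _, ⟨H⟩⟩ :=
      ((RightHomotopyRel.iff_map_eq (toHo A) X Y).2 h).exists_very_good_pathObject
    have hι : M.tcof P.ι := mem_trivialCofibrations P.ι
    have hC := trivial_cokernel hM hι
    let d : cokernel P.ι ⟶ Y := cokernel.desc P.ι (P.p₀ - P.p₁) (by simp [Preadditive.comp_sub])
    let I := Injective.under (cokernel P.ι)
    have hS : (ShortComplex.mk (Injective.ι (cokernel P.ι)) _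
        (cokernel.condition _)).ShortExact :=
      { exact := ShortComplex.exact_of_g_is_cokernel _ (cokernelIsCokernel _) }
    obtain ⟨s, hs⟩ := exists_extension ((tcof_f_iff hM hS).2
      (coresolving_trivial hM _ hS hC (trivial_of_injective hM _))) hY d
    refine ⟨I, inferInstance, H.h ≫ cokernel.π P.ι ≫ Injective.ι _, s, ?_⟩
    dsimp at hs
    rw [Category.assoc, Category.assoc, hs, cokernel.π_desc, Preadditive.comp_sub, H.h₀, H.h₁]
    abel
  · rintro ⟨I, hI, i, s, rfl⟩
    have : IsFibrant I := fibrant_of_injective hM I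
    have : WeakEquivalence (terminal.from I) := by
      have h : WeakEquivalence (initial.to I) := trivial_of_injective hM I
      have : IsIso (initial.to I ≫ terminal.from I) :=
        ⟨0, (initialIsInitial (C := A)).hom_ext _ _, (terminalIsTerminal (C := A)).hom_ext _ _⟩
      exact weakEquivalence_of_precomp (initial.to I) _
    exact toHo_map_add g i s

/-- Both the source and the target of a fibration can be replaced by fibrant objects without
changing its kernel. -/
lemma exists_fibrant_square (h₁ : M₁.IsInjective) {Y Z : A} (p : Y ⟶ Z) (hp : M₁.fib p) :
    ∃ (Y' Z' : A) (j : Y ⟶ Y') (j' : Z ⟶ Z') (p' : Y' ⟶ Z') (i : kernel p ⟶ Y') (w : i ≫ p' = 0),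
      M₁.tcof j ∧ M₁.tcof j' ∧ M₁.fibrant Y' ∧ M₁.fibrant Z' ∧ p ≫ j' = j ≫ p' ∧
      (ShortComplex.mk i p' w).ShortExact := by
  obtain ⟨Y', j, hj, hY'⟩ := exists_fibrantReplacement M₁ Y
  have := hj.mono h₁
  have := hp.epi
  have hS := shortExact_pushout p j
  exact ⟨Y', pushout p j, j, pushout.inl p j, pushout.inr p j, _, _, hj,
    M₁.tcof.of_isPushout (IsPushout.of_hasPushout p j) hj, hY',
    coresolving_fibrant h₁ _ hS ((fib_iff p).1 hp).2 hY', pushout.condition, hS⟩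

/-! ### Comparison of two injective abelian model structures -/

section

variable (h₁ : M₁.IsInjective) (h₂ : M₂.IsInjective) (hF : M₂.fibrant ≤ M₁.fibrant)

include hF in
lemma fib_le : M₂.fib ≤ M₁.fib := fun _ _ p hp => by
  rw [fib_iff] at hp ⊢
  exact ⟨hp.1, hF _ hp.2⟩

include hF in
lemma tcof_le : M₁.tcof ≤ M₂.tcof := by
  rw [← MorphismProperty.llp_eq_of_wfs M₁.tcof M₁.fib,
    ← MorphismProperty.llp_eq_of_wfs M₂.tcof M₂.fib]
  exact MorphismProperty.antitone_llp (fib_le hF)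

include h₁ h₂ hF in
lemma trivial_le : M₁.trivial ≤ M₂.trivial := fun X hX => by
  rw [trivial_iff_tcof h₁] at hX
  rw [trivial_iff_tcof h₂]
  exact tcof_le hF _ hX

include h₁ h₂ hF in
/-- Surjectivity lifts a map `X ⟶ Z` along `p`. For injectivity, a null-homotopic composite
`X ⟶ Y ⟶ Z` factors through a monomorphism from `X` to an injective object, which is a trivial
cofibration of `M₂`, so that the null homotopy lifts along `p`. -/
lemma bijective_comp_toHo_map {X Y Z : A} (hX : M₂.trivial X) (p : Y ⟶ Z) (hp : M₂.fib p)
    (hY : M₁.fibrant Y) (hZ : M₁.fibrant Z) :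
    letI := M₁.model
    Function.Bijective (fun a : (toHo A).obj X ⟶ (toHo A).obj Y => a ≫ (toHo A).map p) := by
  let := M₁.model
  have := enoughInjectives h₁
  constructor
  · intro a b hab
    obtain ⟨a, rfl⟩ := toHo_map_surjective h₁ X hY a
    obtain ⟨b, rfl⟩ := toHo_map_surjective h₁ X hY b
    dsimp at hab
    rw [← Functor.map_comp, ← Functor.map_comp, toHo_map_eq_iff h₁ hZ] at hab
    obtain ⟨I, _, i, s, h⟩ := hab
    -- enlarge `I` so that the map from `X` becomes a monomorphism
    let m : X ⟶ I ⊞ Injective.under X := biprod.lift i (Injective.ι X)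
    have hm : m ≫ biprod.fst = i := biprod.lift_fst _ _
    have : Mono m := by
      have : Mono (m ≫ biprod.snd) := by rw [biprod.lift_snd]; infer_instance
      exact mono_of_mono m biprod.snd
    have hS : (ShortComplex.mk m _ (cokernel.condition _)).ShortExact :=
      { exact := ShortComplex.exact_of_g_is_cokernel _ (cokernelIsCokernel _) }
    obtain ⟨l, hl, -⟩ := exists_lift ((tcof_f_iff h₂ hS).2
      (coresolving_trivial h₂ _ hS hX (trivial_of_injective h₂ _))) hp (a - b)
      (biprod.fst ≫ s) (by
        dsimp
        rw [reassoc_of% hm, Preadditive.sub_comp, h]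
        abel)
    refine (toHo_map_eq_iff h₁ hY a b).2 ⟨_, inferInstance, m, l, ?_⟩
    dsimp at hl
    rw [hl]
    abel
  · intro b
    obtain ⟨b, rfl⟩ := toHo_map_surjective h₁ X hZ b
    obtain ⟨l, rfl⟩ := (trivial_iff_exists_lift h₂).1 hX p hp b
    exact ⟨(toHo A).map l, ((toHo A).map_comp _ _).symm⟩

include h₁ h₂ hF in
/-- The loop functor of `M₁` sends a fibration of `M₂` between fibrant objects of `M₁` to a
morphism of the same kind. -/
lemma exists_loop_fib {Y Z : A} (p : Y ⟶ Z) (hp : M₂.fib p) (hY : M₁.fibrant Y)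
    (hZ : M₁.fibrant Z) :
    letI := M₁.model
    ∃ (Y' Z' : A) (p' : Y' ⟶ Z'), M₂.fib p' ∧ M₁.fibrant Y' ∧ M₁.fibrant Z' ∧
      Nonempty (Arrow.mk ((loopFunctor A).map ((toHo A).map p)) ≅ Arrow.mk ((toHo A).map p')) := by
  let := M₁.model
  obtain ⟨Q, q, hq, hQ, hQ'⟩ := exists_path Z
  -- a path fibration in `M₂` over the pullback of `p` and `q`
  obtain ⟨P, r, hr, hP⟩ := exists_fib_of_trivial h₂ (pullback p q)
  have hq₁ : M₁.fib q := hq.mem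
  have hQinj : Injective Q := (injective_iff h₁).2 ⟨hQ', fibrant_of_fib hq₁ hZ⟩
  have hsnd : M₂.fib (pullback.snd p q) := MorphismProperty.pullback_snd _ _ hp
  have hfst : M₁.fib (pullback.fst p q) := MorphismProperty.pullback_fst _ _ hq₁
  have hPinj : Injective P := (injective_iff h₂).2 ⟨hP,
    fibrant_of_fib (M₂.fib.comp_mem _ _ hr hsnd) (fibrant_of_injective h₂ Q)⟩
  let D : LoopData Y :=
    { Y' := Y
      P := P
      r := 𝟙 Y
      p := r ≫ pullback.fst p q
      cof_r := inferInstance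
      weq_r := inferInstance
      fib_Y' := hY
      fib_p := ⟨M₁.fib.comp_mem _ _ (fib_le hF _ hr) hfst⟩
      cof_P := h₁ P
      weq_P := trivial_of_injective h₁ P }
  let E : LoopData Z :=
    { Y' := Z
      P := Q
      r := 𝟙 Z
      p := q
      cof_r := inferInstance
      weq_r := inferInstance
      fib_Y' := hZ
      fib_p := hq
      cof_P := hQ
      weq_P := hQ' }
  let φ : D.Hom E p :=
    { f' := p
      e := r ≫ pullback.snd p q
      wr := by simp [D, E]
      wp := by simp [D, E, pullback.condition] }
  refine ⟨D.loop, E.loop, φ.loop, ?_, ((fib_iff D.p).1 D.fib_p.mem).2,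
    ((fib_iff E.p).1 E.fib_p.mem).2, loopFunctor_map_arrow_iso φ⟩
  -- the induced map of kernels is a base change of the fibration `r`
  let j : E.loop ⟶ pullback p q := pullback.lift 0 (kernel.ι E.p) (by simp [E])
  have hj₁ : j ≫ pullback.fst p q = 0 := pullback.lift_fst _ _ _
  have hj₂ : j ≫ pullback.snd p q = kernel.ι E.p := pullback.lift_snd _ _ _
  have hD : kernel.ι D.p ≫ r ≫ pullback.fst p q = 0 := kernel.condition D.p
  have hι : φ.loop ≫ kernel.ι E.p = kernel.ι D.p ≫ r ≫ pullback.snd p q := φ.loop_ι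
  have hpb : IsPullback φ.loop (kernel.ι D.p) j r := by
    refine ⟨⟨?_⟩, ⟨PullbackCone.IsLimit.mk _ (fun s => kernel.lift D.p s.snd ?_) ?_ ?_ ?_⟩⟩
    · apply pullback.hom_ext
      · rw [Category.assoc, Category.assoc, hj₁, hD, comp_zero]
      · rw [Category.assoc, Category.assoc, hj₂, hι]
    · have := s.condition =≫ pullback.fst p q
      rw [Category.assoc, Category.assoc, hj₁, comp_zero] at this
      exact this.symm
    · intro s
      have := s.condition =≫ pullback.snd p q
      rw [Category.assoc, Category.assoc, hj₂] at this
      rw [← cancel_mono (kernel.ι E.p), Category.assoc, hι, kernel.lift_ι_assoc]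
      exact this.symm
    · intro s
      simp
    · intro s m _ hm
      rw [← cancel_mono (kernel.ι D.p), hm, kernel.lift_ι]
  exact M₂.fib.of_isPullback hpb.flip hr

include h₁ h₂ hF in
lemma exists_iterLoop_fib {Y Z : A} (p : Y ⟶ Z) (hp : M₂.fib p) (hY : M₁.fibrant Y)
    (hZ : M₁.fibrant Z) (k : ℕ) :
    letI := M₁.model
    ∃ (Y' Z' : A) (p' : Y' ⟶ Z'), M₂.fib p' ∧ M₁.fibrant Y' ∧ M₁.fibrant Z' ∧
      Nonempty (Arrow.mk ((iterLoop A k).map ((toHo A).map p)) ≅ Arrow.mk ((toHo A).map p')) := by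
  let := M₁.model
  induction k with
  | zero => exact ⟨Y, Z, p, hp, hY, hZ, ⟨Iso.refl _⟩⟩
  | succ k ih =>
    obtain ⟨Y', Z', p', hp', hY', hZ', ⟨e⟩⟩ := ih
    obtain ⟨Y'', Z'', p'', hp'', hY'', hZ'', ⟨e'⟩⟩ := exists_loop_fib h₁ h₂ hF p' hp' hY' hZ'
    exact ⟨Y'', Z'', p'', hp'', hY'', hZ'', ⟨(loopFunctor A).mapArrow.mapIso e ≪≫ e'⟩⟩

include h₁ h₂ hF in
/-- A fibration of `M₂` induces bijections on maps in the homotopy category of `M₁` from the weakly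
trivial objects of `M₂`. -/
lemma loopBijective_of_fib {X Y Z : A} (hX : M₂.trivial X) (p : Y ⟶ Z) (hp : M₂.fib p) :
    letI := M₁.model
    LoopBijective X p := by
  let := M₁.model
  obtain ⟨Y', Z', j, j', p', i, w, hj, hj', hY', hZ', fac, hS⟩ :=
    exists_fibrant_square h₁ p (fib_le hF _ hp)
  have : WeakEquivalence j := ⟨hj.2⟩
  have : WeakEquivalence j' := ⟨hj'.2⟩
  have hp' : M₂.fib p' := (fib_g_iff hS).2 ((fib_iff p).1 hp).2
  refine (LoopBijective.of_weakEquivalence X j').of_postcomp ?_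
  rw [fac]
  refine (LoopBijective.of_weakEquivalence X j).comp fun k => ?_
  obtain ⟨Y'', Z'', p'', hp'', hY'', hZ'', ⟨e⟩⟩ := exists_iterLoop_fib h₁ h₂ hF p' hp' hY' hZ' k
  exact bijective_comp_of_arrow_iso e _ (bijective_comp_toHo_map h₁ h₂ hF hX p'' hp'' hY'' hZ'')

include h₁ in
/-- Let `p` be a fibration between fibrant objects that induces a bijection on maps from `X` in the
homotopy category, and a surjection after passage to loop objects. Then every map from `X` to the
kernel of `p` factors through an injective object. The reason is that the kernel of `p` is the
cokernel of the map of loop objects when the loop object of the target of `p` is computed with the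
path fibration of the source, followed by `p`. -/
lemma exists_factor_injective {X K Y Z : A} {ι : K ⟶ Y} {p : Y ⟶ Z} {w : ι ≫ p = 0}
    (hS : (ShortComplex.mk ι p w).ShortExact) (hK : M₁.fibrant K)
    (hY : M₁.fibrant Y) (hZ : M₁.fibrant Z)
    (hp : letI := M₁.model; LoopBijective X p) (g : X ⟶ K) :
    ∃ (I : A) (_ : Injective I) (i : X ⟶ I) (s : I ⟶ K), g = i ≫ s := by
  let := M₁.model
  have : Mono ι := hS.mono_f
  have hpf : M₁.fib p := (fib_g_iff hS).2 hK
  obtain ⟨Q, q, hq, hQ, hQ'⟩ := exists_path Y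
  -- the composite `X ⟶ K ⟶ Y` lifts to the path fibration
  obtain ⟨y, hy⟩ : ∃ y : X ⟶ Q, y ≫ q = g ≫ ι := by
    have h : (toHo A).map (g ≫ ι) = (toHo A).map 0 := by
      refine (hp 0).1 ?_
      change (toHo A).map (g ≫ ι) ≫ (toHo A).map p = (toHo A).map 0 ≫ (toHo A).map p
      rw [← Functor.map_comp, ← Functor.map_comp, Category.assoc, w, comp_zero, zero_comp]
    obtain ⟨I, _, i, s, h⟩ := (toHo_map_eq_iff h₁ hY _ _).1 h
    obtain ⟨s', rfl⟩ := (trivial_iff_exists_lift h₁).1 (trivial_of_injective h₁ I) q hq.mem s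
    exact ⟨i ≫ s', by rw [h, zero_add, Category.assoc]⟩
  let D : LoopData Y :=
    { Y' := Y
      P := Q
      r := 𝟙 Y
      p := q
      cof_r := inferInstance
      weq_r := inferInstance
      fib_Y' := hY
      fib_p := hq
      cof_P := hQ
      weq_P := hQ' }
  let E : LoopData Z :=
    { Y' := Z
      P := Q
      r := 𝟙 Z
      p := q ≫ p
      cof_r := inferInstance
      weq_r := inferInstance
      fib_Y' := hZ
      fib_p := ⟨M₁.fib.comp_mem _ _ hq.mem hpf⟩
      cof_P := hQ
      weq_P := hQ' }
  let φ : D.Hom E p :=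
    { f' := p
      e := 𝟙 Q
      wr := by simp [D, E]
      wp := by simp [D, E] }
  have hφ : φ.loop ≫ kernel.ι E.p = kernel.ι D.p := φ.loop_ι.trans (Category.comp_id _)
  let κ : E.loop ⟶ K := hS.exact.lift (kernel.ι E.p ≫ q)
    ((Category.assoc _ _ _).trans (kernel.condition E.p))
  have hκ : κ ≫ ι = kernel.ι E.p ≫ q := hS.exact.lift_f _ _
  have hφκ : φ.loop ≫ κ = 0 := by
    rw [← cancel_mono ι, Category.assoc, hκ, reassoc_of% hφ, zero_comp]
    exact kernel.condition D.p
  let z : X ⟶ E.loop := kernel.lift E.p y (by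
    dsimp [E]
    rw [reassoc_of% hy, w, comp_zero])
  have hz : z ≫ κ = g := by
    rw [← cancel_mono ι, Category.assoc, hκ, kernel.lift_ι_assoc, hy]
  have hDf : M₁.fibrant D.loop := ((fib_iff D.p).1 D.fib_p.mem).2
  have hEf : M₁.fibrant E.loop := ((fib_iff E.p).1 E.fib_p.mem).2
  obtain ⟨e⟩ := loopFunctor_map_arrow_iso φ
  obtain ⟨z', hz'⟩ := (bijective_comp_of_arrow_iso e.symm _ (hp 1)).2 ((toHo A).map z)
  obtain ⟨z', rfl⟩ := toHo_map_surjective h₁ X hDf z'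
  dsimp at hz'
  rw [← Functor.map_comp, eq_comm, toHo_map_eq_iff h₁ hEf] at hz'
  obtain ⟨I, hI, i, s, h⟩ := hz'
  refine ⟨I, hI, i, s ≫ κ, ?_⟩
  rw [← hz, h, Preadditive.add_comp, Category.assoc, Category.assoc, hφκ, comp_zero, zero_add]

include h₁ h₂ hF in
/-- A fibration of `M₁` that induces bijections on maps in the homotopy category of `M₁` from the
weakly trivial objects of `M₂` is a fibration of `M₂`. -/
lemma fib_of_loopBijective {Y Z : A} (p : Y ⟶ Z) (hp : M₁.fib p)
    (h : letI := M₁.model; ∀ X, M₂.trivial X → LoopBijective X p) : M₂.fib p := by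
  let := M₁.model
  obtain ⟨Y', Z', j, j', p', i, w, hj, hj', hY', hZ', fac, hS⟩ := exists_fibrant_square h₁ p hp
  have : WeakEquivalence j := ⟨hj.2⟩
  have : WeakEquivalence j' := ⟨hj'.2⟩
  rw [fib_iff]
  refine ⟨hp.epi, fibrant_of_exists_extension h₂ M₁.trivial (trivial_le h₁ h₂ hF) (fun X => ?_) _
    fun T P m hm hT hP a => ?_⟩
  · obtain ⟨P, q, hq, hP⟩ := exists_fib_of_trivial h₁ X
    exact ⟨P, q, hq.epi, hP⟩
  · have hp' : LoopBijective T p' := by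
      refine (LoopBijective.of_weakEquivalence T j).of_precomp ?_
      rw [← fac]
      exact (h T hT).comp (.of_weakEquivalence T j')
    obtain ⟨I, _, i, s, rfl⟩ :=
      exists_factor_injective h₁ hS ((fib_iff p).1 hp).2 hY' hZ' hp' a
    have := hm.mono h₂
    exact ⟨Injective.factorThru i m ≫ s, by simp⟩

include h₁ h₂ hF in
/-- The colocal objects for the maps `0 ⟶ F` with `F` fibrant in `M₂` are the weakly trivial
objects of `M₂`: a fibrant replacement of a colocal object `X` in `M₂` factors through an injective
object, which forces `X` to be weakly trivial. -/
lemma colocalObjects_zeroMapsTo :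
    (letI := M₁.model; colocalObjects (zeroMapsTo M₂.fibrant)) = M₂.trivial := by
  let := M₁.model
  ext X
  constructor
  · intro hX
    obtain ⟨R, r, hr, hR⟩ := exists_fibrantReplacement M₂ X
    have := hr.mono h₂
    obtain ⟨g, hg⟩ := (hX _ (MorphismProperty.ofHoms.mk ⟨R, hR⟩) 0).2 ((toHo A).map r)
    change (toHo A).obj X ⟶ (toHo A).obj 0 at g
    obtain ⟨g, rfl⟩ := toHo_map_surjective h₁ X (fibrant_of_isZero (isZero_zero A)) g
    change (toHo A).map g ≫ (toHo A).map 0 = _ at hg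
    rw [← Functor.map_comp, comp_zero, eq_comm, toHo_map_eq_iff h₁ (hF _ hR)] at hg
    obtain ⟨I, _, i, s, hr'⟩ := hg
    rw [zero_add] at hr'
    -- `r` factors through `I`, so that the identity of `R` is the sum of a map through `I` and a
    -- map through the cokernel of `r`
    let e : R ⟶ I := Injective.factorThru i r
    have he : r ≫ e = i := Injective.comp_factorThru _ _
    let t : cokernel r ⟶ R := cokernel.desc r (𝟙 R - e ≫ s) (by
      rw [Preadditive.comp_sub, reassoc_of% he, ← hr', Category.comp_id, sub_self])
    have ht : cokernel.π r ≫ t = 𝟙 R - e ≫ s := cokernel.π_desc _ _ _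
    have hC := trivial_cokernel h₂ hr
    have hRt : M₂.trivial R := by
      rw [trivial_iff_exists_lift h₂] at hC ⊢
      intro E B p hp b
      obtain ⟨l₁, hl₁⟩ := (trivial_iff_exists_lift h₂).1 (trivial_of_injective h₂ I) p hp (s ≫ b)
      obtain ⟨l₂, hl₂⟩ := hC p hp (t ≫ b)
      refine ⟨e ≫ l₁ + cokernel.π r ≫ l₂, ?_⟩
      rw [Preadditive.add_comp, Category.assoc, Category.assoc, hl₁, hl₂, reassoc_of% ht,
        Preadditive.sub_comp, Category.id_comp, Category.assoc]
      abel
    have hS : (ShortComplex.mk r _ (cokernel.condition _)).ShortExact :=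
      { exact := ShortComplex.exact_of_g_is_cokernel _ (cokernelIsCokernel _) }
    exact resolving_trivial h₂ _ hS hRt hC
  · rintro hX _ _ _ ⟨F⟩
    have h := loopBijective_of_fib h₁ h₂ hF hX (0 : F.1 ⟶ 0)
      ((fibrant_iff_of_isZero _ (isZero_zero A)).1 F.2)
    refine h.of_postcomp ?_
    rw [(isZero_zero A).eq_of_src ((0 : (0 : A) ⟶ F.1) ≫ 0) (𝟙 _)]
    exact .of_weakEquivalence _ (𝟙 _)

end

end AbelianModelStructure

end AbelianModel

namespace AbelianModel

namespace AbelianModelStructure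

/-! ### The right localization -/

variable {A : Type u} [Category.{v} A] [Abelian A] {M M₁ M₂ : AbelianModelStructure A}

/-- The weak equivalences of `M₁/M₂`, defined as the colocal equivalences of `M₁` for the maps
`0 ⟶ F` with `F` fibrant in `M₂`. -/
def colocalWeq (M₁ M₂ : AbelianModelStructure A) : MorphismProperty A :=
  letI := M₁.model; colocalEquivalences (colocalObjects (zeroMapsTo M₂.fibrant))

instance : (colocalWeq M₁ M₂).HasTwoOutOfThreeProperty :=
  letI := M₁.model
  inferInstanceAs (colocalEquivalences (colocalObjects _)).HasTwoOutOfThreeProperty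

section

variable (h₁ : M₁.IsInjective) (h₂ : M₂.IsInjective) (hF : M₂.fibrant ≤ M₁.fibrant)

include h₁ h₂ hF in
lemma colocalWeq_iff {X Y : A} (f : X ⟶ Y) : colocalWeq M₁ M₂ f ↔
    letI := M₁.model; ∀ T, M₂.trivial T → LoopBijective T f := by
  let := M₁.model
  have h := colocalObjects_zeroMapsTo h₁ h₂ hF
  exact forall_congr' fun T => by rw [← h]

include h₁ h₂ hF in
/-- The trivial fibrations of `M₁/M₂` are the fibrations of `M₂`. -/
lemma fib_inf_colocalWeq : M₁.fib ⊓ colocalWeq M₁ M₂ = M₂.fib := by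
  ext X Y p
  refine ⟨fun hp => fib_of_loopBijective h₁ h₂ hF p hp.1 ((colocalWeq_iff h₁ h₂ hF p).1 hp.2),
    fun hp => ⟨fib_le hF _ hp, (colocalWeq_iff h₁ h₂ hF p).2 fun T hT =>
      loopBijective_of_fib h₁ h₂ hF hT p hp⟩⟩

lemma tcof_le_colocalWeq (M₁ M₂ : AbelianModelStructure A) :
    M₁.tcof ≤ colocalWeq M₁ M₂ := fun _ _ f hf X _ => by
  let := M₁.model
  have : WeakEquivalence f := ⟨hf.2⟩
  exact .of_weakEquivalence X f

include h₁ h₂ hF in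
/-- The trivial cofibrations of `M₁/M₂` are the trivial cofibrations of `M₁`. -/
lemma tcof_inf_colocalWeq : M₂.tcof ⊓ colocalWeq M₁ M₂ = M₁.tcof := by
  ext X Y f
  refine ⟨fun hf => ?_, fun hf => ⟨tcof_le hF _ hf, tcof_le_colocalWeq M₁ M₂ _ hf⟩⟩
  -- `f` is a retract of the trivial cofibration in its factorization
  let d := MorphismProperty.factorizationData M₁.tcof M₁.fib f
  have hp : M₂.fib d.p := by
    rw [← fib_inf_colocalWeq h₁ h₂ hF]
    refine ⟨d.hp, (colocalWeq M₁ M₂).of_precomp d.i d.p (tcof_le_colocalWeq M₁ M₂ _ d.hi) ?_⟩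
    rw [d.fac]
    exact hf.2
  have := MorphismProperty.hasLiftingProperty_of_wfs f d.p hf.1 hp
  exact MorphismProperty.of_retract (RetractArrow.ofLeftLiftingProperty d.fac) d.hi

/-- The model structure of `M₁/M₂`: its cofibrations are the trivial cofibrations of `M₂` and its
fibrations are those of `M₁`. Its trivial fibrations are then the fibrations of `M₂` and its trivial
cofibrations are those of `M₁`, so that both weak factorization systems are given. -/
@[reducible]
def rightLocalizationModel : ModelCategory A :=
  letI : CategoryWithCofibrations A := ⟨M₂.tcof⟩
  letI : CategoryWithFibrations A := ⟨M₁.fib⟩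
  letI : CategoryWithWeakEquivalences A := ⟨colocalWeq M₁ M₂⟩
  haveI : (weakEquivalences A).HasTwoOutOfThreeProperty :=
    inferInstanceAs (colocalWeq M₁ M₂).HasTwoOutOfThreeProperty
  haveI : MorphismProperty.IsWeakFactorizationSystem (cofibrations A) (trivialFibrations A) := by
    change MorphismProperty.IsWeakFactorizationSystem M₂.tcof (M₁.fib ⊓ colocalWeq M₁ M₂)
    rw [fib_inf_colocalWeq h₁ h₂ hF]
    infer_instance
  haveI : MorphismProperty.IsWeakFactorizationSystem (trivialCofibrations A) (fibrations A) := by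
    change MorphismProperty.IsWeakFactorizationSystem (M₂.tcof ⊓ colocalWeq M₁ M₂) M₁.fib
    rw [tcof_inf_colocalWeq h₁ h₂ hF]
    infer_instance
  ModelCategory.mk' A

/-- The abelian model structure `M₁/M₂`. -/
def rightLocalization : AbelianModelStructure A where
  model := rightLocalizationModel h₁ h₂ hF
  cofibration_iff f := by
    let := rightLocalizationModel h₁ h₂ hF
    refine (HomotopicalAlgebra.cofibration_iff f).trans ((tcof_iff h₂ f).trans ?_)
    rw [trivial_iff_tcof h₂]
    exact and_congr_right fun _ =>
      (HomotopicalAlgebra.cofibration_iff (initial.to (cokernel f))).symm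
  fibration_iff f := by
    let := rightLocalizationModel h₁ h₂ hF
    refine (HomotopicalAlgebra.fibration_iff f).trans ((fib_iff f).trans ?_)
    exact and_congr_right fun _ => (fibrant_iff_of_isZero (terminal.from _)
      ((isZero_zero A).of_iso HasZeroObject.zeroIsoTerminal.symm)).trans
        (HomotopicalAlgebra.fibration_iff _).symm

lemma rightLocalization_cofibrant_iff (X : A) :
    (rightLocalization h₁ h₂ hF).cofibrant X ↔ M₂.trivial X :=
  letI := rightLocalizationModel h₁ h₂ hF
  (HomotopicalAlgebra.cofibration_iff _).trans (trivial_iff_tcof h₂).symm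

lemma rightLocalization_fibrant_iff (X : A) :
    (rightLocalization h₁ h₂ hF).fibrant X ↔ M₁.fibrant X :=
  (fibrant_iff_of_isZero 0 (isZero_zero A)).trans
    (fibrant_iff_of_isZero (M := M₁) (0 : X ⟶ 0) (isZero_zero A)).symm

lemma rightLocalization_trivial_iff_initial (X : A) :
    (rightLocalization h₁ h₂ hF).trivial X ↔ colocalWeq M₁ M₂ (initial.to X) :=
  letI := rightLocalizationModel h₁ h₂ hF
  HomotopicalAlgebra.weakEquivalence_iff _

lemma rightLocalization_trivial_iff_zero (X : A) :
    (rightLocalization h₁ h₂ hF).trivial X ↔ colocalWeq M₁ M₂ (0 : X ⟶ 0) := by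
  let := rightLocalizationModel h₁ h₂ hF
  have : IsIso (initial.to X ≫ (0 : X ⟶ 0)) :=
    ⟨0, (initialIsInitial (C := A)).hom_ext _ _, (isZero_zero A).eq_of_src _ _⟩
  have h : WeakEquivalence (initial.to X ≫ (0 : X ⟶ 0)) := inferInstance
  refine Iff.trans ?_ (HomotopicalAlgebra.weakEquivalence_iff (0 : X ⟶ 0))
  exact ⟨fun h' => have : WeakEquivalence (initial.to X) := h'
    weakEquivalence_of_precomp (initial.to X) _,
    fun _ => weakEquivalence_of_postcomp (initial.to X) (0 : X ⟶ 0)⟩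

lemma rightLocalization_cofibrant_trivial_iff (X : A) :
    ((rightLocalization h₁ h₂ hF).cofibrant ⊓ (rightLocalization h₁ h₂ hF).trivial) X ↔
      M₁.trivial X := by
  rw [trivial_iff_tcof h₁, ← tcof_inf_colocalWeq h₁ h₂ hF]
  exact and_congr ((rightLocalization_cofibrant_iff h₁ h₂ hF X).trans (trivial_iff_tcof h₂))
    (rightLocalization_trivial_iff_initial h₁ h₂ hF X)

lemma rightLocalization_trivial_fibrant_iff (X : A) :
    ((rightLocalization h₁ h₂ hF).trivial ⊓ (rightLocalization h₁ h₂ hF).fibrant) X ↔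
      M₂.fibrant X := by
  rw [fibrant_iff_of_isZero (M := M₂) (0 : X ⟶ 0) (isZero_zero A), ← fib_inf_colocalWeq h₁ h₂ hF]
  exact (and_congr (rightLocalization_trivial_iff_zero h₁ h₂ hF X)
    ((rightLocalization_fibrant_iff h₁ h₂ hF X).trans
      (fibrant_iff_of_isZero _ (isZero_zero A)))).trans and_comm

lemma rightLocalization_isHereditary : (rightLocalization h₁ h₂ hF).IsHereditary where
  resolving S hS := by
    simp only [rightLocalization_cofibrant_iff]
    exact resolving_trivial h₂ S hS
  coresolving S hS := by
    simp only [rightLocalization_trivial_fibrant_iff]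
    exact coresolving_fibrant h₂ S hS
  resolving' S hS := by
    simp only [rightLocalization_cofibrant_trivial_iff]
    exact resolving_trivial h₁ S hS
  coresolving' S hS := by
    simp only [rightLocalization_fibrant_iff]
    exact coresolving_fibrant h₁ S hS

lemma rightLocalization_trivial_iff (X : A) : (rightLocalization h₁ h₂ hF).trivial X ↔
    ∃ (F W : A) (i : X ⟶ F) (p : F ⟶ W) (w : i ≫ p = 0),
      (ShortComplex.mk i p w).ShortExact ∧ M₂.fibrant F ∧ M₁.trivial W := by
  -- a trivial cofibration of `M₁` does not change the property of being weakly trivial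
  have key {Y : A} (j : X ⟶ Y) (hj : M₁.tcof j) :
      colocalWeq M₁ M₂ (0 : X ⟶ 0) ↔ colocalWeq M₁ M₂ (0 : Y ⟶ 0) := by
    rw [show (0 : X ⟶ 0) = j ≫ (0 : Y ⟶ 0) by simp]
    exact ⟨fun h => (colocalWeq M₁ M₂).of_precomp _ _ (tcof_le_colocalWeq M₁ M₂ _ hj) h,
      fun h => (colocalWeq M₁ M₂).comp_mem _ _ (tcof_le_colocalWeq M₁ M₂ _ hj) h⟩
  rw [rightLocalization_trivial_iff_zero]
  constructor
  · intro hX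
    obtain ⟨R, j, hj, hR⟩ := exists_fibrantReplacement M₁ X
    have := hj.mono h₁
    refine ⟨R, cokernel j, j, cokernel.π j, cokernel.condition j,
      { exact := ShortComplex.exact_of_g_is_cokernel _ (cokernelIsCokernel _) }, ?_,
      trivial_cokernel h₁ hj⟩
    rw [key j hj] at hX
    rw [fibrant_iff_of_isZero (0 : R ⟶ 0) (isZero_zero A), ← fib_inf_colocalWeq h₁ h₂ hF]
    exact ⟨(fibrant_iff_of_isZero _ (isZero_zero A)).1 hR, hX⟩
  · rintro ⟨F, W, i, p, w, hS, hF', hW⟩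
    rw [key i ((tcof_f_iff h₁ hS).2 hW)]
    rw [fibrant_iff_of_isZero (0 : F ⟶ 0) (isZero_zero A), ← fib_inf_colocalWeq h₁ h₂ hF] at hF'
    exact hF'.2

lemma isRightLocalization_rightLocalization :
    IsRightLocalization M₁ M₂ (rightLocalization h₁ h₂ hF) where
  hereditary := rightLocalization_isHereditary h₁ h₂ hF
  cofibrant_iff := rightLocalization_cofibrant_iff h₁ h₂ hF
  fibrant_iff := rightLocalization_fibrant_iff h₁ h₂ hF
  trivial_iff := rightLocalization_trivial_iff h₁ h₂ hF

lemma fib_eq_of_isRightLocalization (h : IsRightLocalization M₁ M₂ M) : M.fib = M₁.fib := by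
  ext X Y p
  rw [fib_iff, fib_iff, h.fibrant_iff]

include h₂ in
lemma cofibrations_eq_of_isRightLocalization (h : IsRightLocalization M₁ M₂ M) :
    (letI := M.model; cofibrations A) = M₂.tcof := by
  let := M.model
  ext X Y f
  rw [tcof_iff h₂, ← h.cofibrant_iff]
  exact (HomotopicalAlgebra.cofibration_iff f).symm.trans (M.cofibration_iff f)

include h₁ h₂ hF in
/-- The cofibrations and fibrations of `M` are known, and they determine its weak equivalences. -/
lemma weakEquivalences_eq_of_isRightLocalization (h : IsRightLocalization M₁ M₂ M) :
    (letI := M.model; weakEquivalences A) = colocalWeq M₁ M₂ := by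
  let := M.model
  have hc : cofibrations A = M₂.tcof := cofibrations_eq_of_isRightLocalization h₂ h
  have hf : fibrations A = M₁.fib := fib_eq_of_isRightLocalization h
  have htf : trivialFibrations A = M₂.fib := by
    rw [← cofibrations_rlp, hc, MorphismProperty.rlp_eq_of_wfs M₂.tcof M₂.fib]
  have htc : trivialCofibrations A = M₁.tcof := by
    rw [← fibrations_llp, hf, MorphismProperty.llp_eq_of_wfs M₁.tcof M₁.fib]
  ext X Y f
  -- `f` is a weak equivalence for either class if and only if `d.p` is a fibration of `M₂`
  let d := MorphismProperty.factorizationData M₁.tcof M₁.fib f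
  have hi : weakEquivalences A d.i := (htc.symm ▸ d.hi : trivialCofibrations A d.i).2
  have hp : weakEquivalences A d.p ↔ colocalWeq M₁ M₂ d.p := by
    have e : fibrations A ⊓ weakEquivalences A = M₁.fib ⊓ colocalWeq M₁ M₂ :=
      htf.trans (fib_inf_colocalWeq h₁ h₂ hF).symm
    have e' := congrFun (congrFun (congrFun e _) _) d.p
    exact ⟨fun h => (e' ▸ (⟨hf.symm ▸ d.hp, h⟩ : (fibrations A ⊓ weakEquivalences A) d.p) :
        (M₁.fib ⊓ colocalWeq M₁ M₂) d.p).2,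
      fun h => (e'.symm ▸ (⟨d.hp, h⟩ : (M₁.fib ⊓ colocalWeq M₁ M₂) d.p) :
        (fibrations A ⊓ weakEquivalences A) d.p).2⟩
  rw [← d.fac]
  refine Iff.trans ?_ (hp.trans ?_)
  · exact ⟨fun h => (weakEquivalences A).of_precomp _ _ hi h,
      fun h => (weakEquivalences A).comp_mem _ _ hi h⟩
  · exact ⟨fun h => (colocalWeq M₁ M₂).comp_mem _ _ (tcof_le_colocalWeq M₁ M₂ _ d.hi) h,
      fun h => (colocalWeq M₁ M₂).of_precomp _ _ (tcof_le_colocalWeq M₁ M₂ _ d.hi) h⟩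

end

end AbelianModelStructure

end AbelianModel

theorem mainTheorem9 {A : Type u} [Category.{v} A] [Abelian A] [HasLimits A] [HasColimits A]
    (M₁ M₂ : AbelianModel.AbelianModelStructure A)
    (h₁ : M₁.IsInjective) (h₂ : M₂.IsInjective) (hF : M₂.fibrant ≤ M₁.fibrant) :
    (∃ M : AbelianModel.AbelianModelStructure A, AbelianModel.IsRightLocalization M₁ M₂ M) ∧
      ∀ M : AbelianModel.AbelianModelStructure A, AbelianModel.IsRightLocalization M₁ M₂ M →
        AbelianModel.IsRightBousfieldLocalization M₁.model M.model
          (AbelianModel.zeroMapsTo M₂.fibrant) := by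
  refine ⟨⟨_, AbelianModel.AbelianModelStructure.isRightLocalization_rightLocalization h₁ h₂ hF⟩,
    fun M h => ?_⟩
  exact
    { weakEquivalences_eq :=
        AbelianModel.AbelianModelStructure.weakEquivalences_eq_of_isRightLocalization h₁ h₂ hF h
      fibrations_eq := AbelianModel.AbelianModelStructure.fib_eq_of_isRightLocalization h
      cofibrations_eq := by
        let := M.model
        exact (trivialFibrations_llp A).symm }
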